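/- Let $p\ge 2$ be a real number and let $E$ be a (real) $\sigma$-Dedekind complete Banach lattice, i.e. a Banach lattice in which every nonempty countable subset that is bounded above has a supremum. Then $E$ has the positive $DP^*$ property of order $p$ if and only if $E$ has the disjoint $DP^*P_p$. Here: - A sequence $(x_n)_n$ in $E$ is weakly $p$-summable if $\sum_n |x^*(x_n)|^p<\infty$ for every $x^*\in E^*$, and disjoint if $|x_m|\wedge|x_n|=0$ whenever $m\ne n$. - A set $K\subseteq E$ is weakly $p$-compact if every sequence in $K$ has a subsequence $(y_n)_n$ for which there is $a\in K$ such that $(y_n-a)_n$ is weakly $p$-summable. - A set $A\subseteq E$ is limited if $\sup_{x\in A}|x_n^*(x)|\to 0$ for every weak* null sequence $(x_n^*)_n$ in $E^*$. A bounded set $A\subseteq E$ is positively limited if $\sup_{x\in A}|x_n^*(x)|\to 0$ for every weak* null sequence $(x_n^*)_n$ of positive functionals in $E^*$. - $E$ has the positive $DP^*$ property of order $p$ if every weakly $p$-compact subset of $E$ is positively limited. - $E$ has the disjoint $DP^*P_p$ (disjoint Dunford-Pettis* property of order $p$) if, for every disjoint weakly $p$-summable sequence $(x_n)_n$ in $E$,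 the set $\{x_n:n\in\mathbb N\}$ is limited. -/

import Mathlib

open Filter Topology

namespace BanachLattice

/-- `σ`-Dedekind completeness: every nonempty countable subset that is bounded above has a
supremum. -/
def IsSigmaDedekindComplete (E : Type*) [Lattice E] : Prop :=
  ∀ s : Set E, s.Nonempty → s.Countable → BddAbove s → ∃ a : E, IsLUB s a

/-- A sequence in a vector lattice is disjoint if its terms are pairwise disjoint:
`|x m| ⊓ |x n| = 0` for `m ≠ n`. -/
def IsDisjointSeq {E : Type*} [AddCommGroup E] [Lattice E] (x : ℕ → E) : Prop :=
  ∀ m n : ℕ, m ≠ n → |x m| ⊓ |x n| = 0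

/-- A sequence is weakly `p`-summable if `∑ |φ (x n)| ^ p < ∞` for every continuous linear
functional `φ`. -/
def IsWeaklyPSummable {X : Type*} [NormedAddCommGroup X] [NormedSpace ℝ X]
    (p : ℝ) (x : ℕ → X) : Prop :=
  ∀ φ : StrongDual ℝ X, Summable fun n => |φ (x n)| ^ p

/-- A set `K` is weakly `p`-compact if every sequence in `K` has a subsequence that is weakly
`p`-convergent to some `a ∈ K`, i.e. whose difference with `a` is weakly `p`-summable. -/
def IsWeaklyPCompact {X : Type*} [NormedAddCommGroup X] [NormedSpace ℝ X]
    (p : ℝ) (K : Set X) : Prop :=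
  ∀ x : ℕ → X, (∀ n, x n ∈ K) →
    ∃ a ∈ K, ∃ θ : ℕ → ℕ, StrictMono θ ∧ IsWeaklyPSummable p fun n => x (θ n) - a

/-- A sequence in the dual that converges to zero in the weak* topology. -/
def IsWeakStarNull {X : Type*} [NormedAddCommGroup X] [NormedSpace ℝ X]
    (f : ℕ → StrongDual ℝ X) : Prop :=
  Tendsto (fun n => StrongDual.toWeakDual (f n)) atTop (𝓝 0)

/-- A set is limited if every weak* null sequence in the dual converges to zero uniformly
on it. -/
def IsLimited {X : Type*} [NormedAddCommGroup X] [NormedSpace ℝ X] (A : Set X) : Prop :=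
  ∀ f : ℕ → StrongDual ℝ X, IsWeakStarNull f →
    TendstoUniformlyOn (fun n x => f n x) (fun _ => 0) atTop A

/-- A bounded set is positively limited if every weak* null sequence of positive functionals
converges to zero uniformly on it. -/
def IsPositivelyLimited {E : Type*} [NormedAddCommGroup E] [NormedSpace ℝ E] [Lattice E]
    (A : Set E) : Prop :=
  Bornology.IsBounded A ∧
    ∀ f : ℕ → StrongDual ℝ E, (∀ n, ∀ x : E, 0 ≤ x → 0 ≤ f n x) → IsWeakStarNull f →
      TendstoUniformlyOn (fun n x => f n x) (fun _ => 0) atTop A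

/-- The disjoint Dunford-Pettis* property of order `p`: every disjoint weakly `p`-summable
sequence is limited (i.e. its set of terms is). -/
def HasDisjointDPStar (p : ℝ) (E : Type*) [NormedAddCommGroup E] [NormedSpace ℝ E]
    [Lattice E] : Prop :=
  ∀ x : ℕ → E, IsDisjointSeq x → IsWeaklyPSummable p x → IsLimited (Set.range x)

/-- The positive Dunford-Pettis* property of order `p`: every weakly `p`-compact set is
positively limited. -/
def HasPositiveDPStar (p : ℝ) (E : Type*) [NormedAddCommGroup E] [NormedSpace ℝ E]
    [Lattice E] : Prop :=
  ∀ K : Set E, IsWeaklyPCompact p K → IsPositivelyLimited K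

end BanachLattice

/-!
**From positive to disjoint.** Given a disjoint sequence `x` and a weak* null sequence `f`,
replace `f n` by the part of `|f n|` carried by the ideal of `x n`. These positive functionals
are again weak* null: tested against `z ≥ 0` they are almost attained at some `w n` in the ideal
of `x n` with `|w n| ≤ z`. The `w n` are disjoint and order bounded, and on such sequences a
weak* null sequence tends to zero: `σ`-Dedekind completeness turns the sequence into an additive
set function on the subsets of `ℕ`, to which Rosenthal's lemma applies. Moreover `|x|` is still
weakly `p`-summable.

**From disjoint to positive.** If positive weak* null functionals stay large on a weakly
`p`-summable sequence, pass to a fast subsequence and subtract from each `|x n|` a large multiple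
of the preceding ones and a fixed majorant; the positive parts are disjoint, dominated by `x`, and
lose little.

In both directions, a disjoint sequence `y` dominated by a weakly `p`-summable `x` is itself
weakly `p`-summable: the parts of `|φ|` carried by the ideals of the `y n` sum to at most `|φ|`,
so that they combine, with suitable signs, into one functional of norm at most `‖φ‖` to be tested
against `x`.
-/

namespace BanachLattice

open scoped Pointwise

section LatticeGroup

variable {G : Type*} [AddCommGroup G] [Lattice G]

theorem inf_eq_zero_mono {a b c d : G} (ha : 0 ≤ a) (hb : 0 ≤ b) (hac : a ≤ c) (hbd : b ≤ d)
    (h : c ⊓ d = 0) : a ⊓ b = 0 :=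
  le_antisymm ((inf_le_inf hac hbd).trans h.le) (le_inf ha hb)

theorem IsDisjointSeq.comp_injective {x : ℕ → G} (hx : IsDisjointSeq x) {θ : ℕ → ℕ}
    (hθ : Function.Injective θ) : IsDisjointSeq (x ∘ θ) :=
  fun _ _ h => hx _ _ (hθ.ne h)

theorem abs_map_le_map_abs {H F : Type*} [AddCommGroup H] [Lattice H] [FunLike F G H]
    [AddMonoidHomClass F G H] {μ : F} (hμ : Monotone μ) (z : G) : |μ z| ≤ μ |z| :=
  abs_le'.2 ⟨hμ (le_abs_self z), by rw [← map_neg]; exact hμ (neg_le_abs z)⟩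

variable [IsOrderedAddMonoid G]

theorem IsDisjointSeq.mono {x y : ℕ → G} (hx : IsDisjointSeq x) (h : ∀ n, |y n| ≤ |x n|) :
    IsDisjointSeq y := fun m n hmn =>
  inf_eq_zero_mono (abs_nonneg _) (abs_nonneg _) (h m) (h n) (hx m n hmn)

theorem add_le_of_inf_eq_zero {a b c : G} (h : a ⊓ b = 0) (ha : a ≤ c) (hb : b ≤ c) :
    a + b ≤ c := by
  rw [← inf_add_sup, h, zero_add]
  exact sup_le ha hb

theorem inf_add_eq_zero {a b c : G} (ha : 0 ≤ a) (hb : 0 ≤ b) (hc : 0 ≤ c)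
    (hab : a ⊓ b = 0) (hac : a ⊓ c = 0) : a ⊓ (b + c) = 0 := by
  have h : a ⊓ (b + c) - c ≤ a ⊓ b :=
    le_inf ((sub_le_self _ hc).trans inf_le_left) (sub_le_iff_le_add.2 inf_le_right)
  rw [hab, sub_nonpos] at h
  exact le_antisymm ((le_inf inf_le_left h).trans hac.le) (le_inf ha (add_nonneg hb hc))

theorem inf_sum_eq_zero {ι : Type*} {s : Finset ι} {a : G} {w : ι → G} (ha : 0 ≤ a)
    (hw : ∀ i ∈ s, 0 ≤ w i) (h : ∀ i ∈ s, a ⊓ w i = 0) : a ⊓ ∑ i ∈ s, w i = 0 := by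
  refine (Finset.sum_induction w (fun b => 0 ≤ b ∧ a ⊓ b = 0) ?_ ⟨le_rfl, inf_of_le_right ha⟩
    fun i hi => ⟨hw i hi, h i hi⟩).2
  rintro b c ⟨hb, hab⟩ ⟨hc, hac⟩
  exact ⟨add_nonneg hb hc, inf_add_eq_zero ha hb hc hab hac⟩

theorem inf_nsmul_eq_zero {a b : G} (ha : 0 ≤ a) (hb : 0 ≤ b) (h : a ⊓ b = 0) (n : ℕ) :
    a ⊓ n • b = 0 := by
  simpa using inf_sum_eq_zero (s := Finset.range n) ha (fun _ _ => hb) fun _ _ => h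

theorem sum_le_of_pairwise_inf_eq_zero {ι : Type*} {s : Finset ι} {w : ι → G} {z : G}
    (hz : 0 ≤ z) (hw : ∀ i ∈ s, 0 ≤ w i) (hwz : ∀ i ∈ s, w i ≤ z)
    (hd : (s : Set ι).Pairwise fun i j => w i ⊓ w j = 0) : ∑ i ∈ s, w i ≤ z := by
  classical
  induction s using Finset.induction_on with
  | empty => simpa using hz
  | insert i s hi ih =>
    rw [Finset.coe_insert, Set.pairwise_insert] at hd
    rw [Finset.forall_mem_insert] at hw hwz
    rw [Finset.sum_insert hi]
    refine add_le_of_inf_eq_zero (inf_sum_eq_zero hw.1 hw.2 fun j hj => ?_) hwz.1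
      (ih hw.2 hwz.2 hd.1)
    exact (hd.2 j hj (ne_of_mem_of_not_mem hj hi).symm).1

theorem abs_finset_sum_le {ι : Type*} (s : Finset ι) (w : ι → G) :
    |∑ i ∈ s, w i| ≤ ∑ i ∈ s, |w i| :=
  Finset.le_sum_of_subadditive _ abs_zero.le abs_add_le s w

theorem abs_nsmul_le (n : ℕ) (w : G) : |n • w| ≤ n • |w| := by
  simpa using abs_finset_sum_le (Finset.range n) fun _ => w

/-- The order ideal generated by `u`: the elements dominated by a multiple of `|u|`. Integer
multiples suffice, so that no scalar action is needed. -/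
def principalIdeal (u : G) : AddSubgroup G where
  carrier := {w | ∃ n : ℕ, |w| ≤ n • |u|}
  zero_mem' := ⟨0, by simp⟩
  add_mem' := by
    rintro v w ⟨m, hm⟩ ⟨n, hn⟩
    exact ⟨m + n, (abs_add_le v w).trans ((add_le_add hm hn).trans (add_nsmul _ m n).ge)⟩
  neg_mem' := by
    rintro w ⟨n, hn⟩
    exact ⟨n, by rwa [abs_neg]⟩

theorem mem_principalIdeal_of_abs_le {u w : G} (h : |w| ≤ |u|) : w ∈ principalIdeal u :=
  ⟨1, by rwa [one_nsmul]⟩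

theorem mem_principalIdeal_mono {u v w : G} (hw : w ∈ principalIdeal u) (h : |v| ≤ |w|) :
    v ∈ principalIdeal u :=
  hw.imp fun _ => h.trans

theorem abs_inf_abs_eq_zero_of_mem_principalIdeal {u v a b : G} (h : |u| ⊓ |v| = 0)
    (ha : a ∈ principalIdeal u) (hb : b ∈ principalIdeal v) : |a| ⊓ |b| = 0 := by
  obtain ⟨m, ha⟩ := ha
  obtain ⟨n, hb⟩ := hb
  refine inf_eq_zero_mono (abs_nonneg a) (abs_nonneg b) ha hb ?_
  refine inf_nsmul_eq_zero (nsmul_nonneg (abs_nonneg u) m) (abs_nonneg v) ?_ n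
  rw [inf_comm] at h ⊢
  exact inf_nsmul_eq_zero (abs_nonneg v) (abs_nonneg u) h m

theorem exists_eq_add_abs_le {w y z : G} (hy : 0 ≤ y) (hz : 0 ≤ z) (h : |w| ≤ y + z) :
    ∃ u v, w = u + v ∧ |u| ≤ y ∧ |v| ≤ z ∧ |u| ≤ |w| := by
  obtain ⟨hw, hnw⟩ := abs_le'.1 h
  have hyw : -y - z ≤ w := by rwa [← neg_add', neg_le]
  have hle : (w ⊓ y) ⊔ -y ≤ w + z :=
    sup_le (inf_le_left.trans (le_add_of_nonneg_right hz)) (sub_le_iff_le_add.1 hyw)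
  have hge : w - z ≤ (w ⊓ y) ⊔ -y :=
    (le_inf (sub_le_self w hz) (sub_le_iff_le_add.2 hw)).trans le_sup_left
  have hyneg : -y ≤ 0 := neg_nonpos.2 hy
  have hwneg : -|w| ≤ 0 := neg_nonpos.2 (abs_nonneg w)
  refine ⟨(w ⊓ y) ⊔ -y, w - ((w ⊓ y) ⊔ -y), by abel, ?_, ?_, ?_⟩
  · exact abs_le'.2 ⟨sup_le inf_le_right (hyneg.trans hy), neg_le.1 le_sup_right⟩
  · exact abs_le'.2 ⟨sub_le_comm.1 hge, by rw [neg_sub]; exact sub_le_iff_le_add'.2 hle⟩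
  · refine abs_le'.2 ⟨sup_le (inf_le_left.trans (le_abs_self w)) (hyneg.trans (abs_nonneg w)), ?_⟩
    exact neg_le.1 ((le_inf (neg_le.1 (neg_le_abs w)) (hwneg.trans hy)).trans le_sup_left)

theorem principalIdeal_abs_le_add (u : G) {y z : G} (hy : 0 ≤ y) (hz : 0 ≤ z) :
    {w ∈ (principalIdeal u : Set G) | |w| ≤ y + z} =
      {w ∈ (principalIdeal u : Set G) | |w| ≤ y} + {w ∈ (principalIdeal u : Set G) | |w| ≤ z} := by
  ext w
  rw [Set.mem_add]
  constructor
  · rintro ⟨hw, hwyz⟩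
    obtain ⟨v, v', rfl, hv, hv', hvw⟩ := exists_eq_add_abs_le hy hz hwyz
    have hvu := mem_principalIdeal_mono hw hvw
    exact ⟨v, ⟨hvu, hv⟩, v', ⟨(AddSubgroup.add_mem_cancel_left _ hvu).1 hw, hv'⟩, rfl⟩
  · rintro ⟨v, ⟨hv, hvy⟩, v', ⟨hv', hvz⟩, rfl⟩
    exact ⟨add_mem hv hv', (abs_add_le v v').trans (add_le_add hvy hvz)⟩

theorem isDisjointSeq_posPart_sub {x : ℕ → G} {s : G} {k : ℕ → ℕ} (hs : 0 ≤ s)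
    (hx : ∀ n, 0 ≤ x n) (hxs : ∀ n, x n ≤ k n • s) :
    IsDisjointSeq fun n => (x n - k n • ∑ i ∈ Finset.range n, x i - s)⁺ := by
  have hsum : ∀ n, 0 ≤ ∑ i ∈ Finset.range n, x i := fun n => Finset.sum_nonneg fun i _ => hx i
  refine fun m n hmn => ?_
  wlog hlt : m < n generalizing m n
  · rw [inf_comm]
    exact this n m hmn.symm (hmn.lt_or_gt.resolve_left hlt)
  have hm : (x m - k m • ∑ i ∈ Finset.range m, x i - s)⁺ ≤ (x m - s)⁺ :=
    posPart_mono (sub_le_sub_right (sub_le_self _ (nsmul_nonneg (hsum m) _)) s)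
  have hn : (x n - k n • ∑ i ∈ Finset.range n, x i - s)⁺ ≤ k n • (x m - s)⁻ := by
    refine sup_le ?_ (nsmul_nonneg (negPart_nonneg _) _)
    calc x n - k n • ∑ i ∈ Finset.range n, x i - s
        ≤ k n • s - k n • x m := by
          refine (sub_le_self _ hs).trans (sub_le_sub (hxs n) (nsmul_le_nsmul_right ?_ _))
          exact Finset.single_le_sum (fun i _ => hx i) (Finset.mem_range.2 hlt)
      _ = k n • -(x m - s) := by rw [neg_sub, nsmul_sub]
      _ ≤ k n • (x m - s)⁻ := nsmul_le_nsmul_right (neg_le_negPart _) _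
  rw [abs_of_nonneg (posPart_nonneg _), abs_of_nonneg (posPart_nonneg _)]
  exact inf_eq_zero_mono (posPart_nonneg _) (posPart_nonneg _) hm hn
    (inf_nsmul_eq_zero (posPart_nonneg _) (negPart_nonneg _) (posPart_inf_negPart_eq_zero _) _)

theorem isLUB_finset_sum {ι : Type*} {s : Finset ι} {A : ι → Set G} {a : ι → G}
    (h : ∀ i ∈ s, IsLUB (A i) (a i)) : IsLUB (∑ i ∈ s, A i) (∑ i ∈ s, a i) := by
  classical
  induction s using Finset.induction_on with
  | empty => exact isLUB_singleton
  | insert i s hi ih =>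
    rw [Finset.forall_mem_insert] at h
    rw [Finset.sum_insert hi, Finset.sum_insert hi]
    exact h.1.add (ih h.2)

theorem isLUB_union_of_inf_eq_zero {A B : Set G} {a b : G} (ha : IsLUB A a) (hb : IsLUB B b)
    (hA : 0 ∈ A) (hB : 0 ∈ B) (hd : ∀ x ∈ A, ∀ y ∈ B, x ⊓ y = 0) : IsLUB (A ∪ B) (a + b) := by
  refine ⟨?_, fun c hc => (ha.add hb).2 ?_⟩
  · rintro x (hx | hx)
    · exact (ha.1 hx).trans (le_add_of_nonneg_right (hb.1 hB))
    · exact (hb.1 hx).trans (le_add_of_nonneg_left (ha.1 hA))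
  · rintro _ ⟨x, hx, y, hy, rfl⟩
    exact add_le_of_inf_eq_zero (hd x hx y hy) (hc (Or.inl hx)) (hc (Or.inr hy))

theorem IsSigmaDedekindComplete.exists_additive_of_isDisjointSeq (hG : IsSigmaDedekindComplete G)
    {y : ℕ → G} {x : G} (hd : IsDisjointSeq y) (hy : ∀ n, 0 ≤ y n) (hyx : ∀ n, y n ≤ x) :
    ∃ s : Set ℕ → G, (∀ A, 0 ≤ s A ∧ s A ≤ x) ∧ (∀ n, s {n} = y n) ∧
      ∀ A B, Disjoint A B → s (A ∪ B) = s A + s B := by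
  have hx : ∀ A : Set ℕ, x ∈ upperBounds (insert 0 (y '' A)) := by
    rintro A _ (rfl | ⟨n, -, rfl⟩)
    exacts [(hy 0).trans (hyx 0), hyx n]
  choose s hs using fun A : Set ℕ =>
    hG _ (Set.insert_nonempty _ _) ((A.to_countable.image y).insert 0) ⟨x, hx A⟩
  refine ⟨s, fun A => ⟨(hs A).1 (Set.mem_insert _ _), (hs A).2 (hx A)⟩, fun n => ?_,
    fun A B hAB => ?_⟩
  · refine (hs {n}).unique ?_
    simpa [sup_of_le_right (hy n)] using isLUB_pair (a := 0) (b := y n)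
  · refine (hs (A ∪ B)).unique ?_
    rw [Set.image_union, Set.insert_union_distrib]
    refine isLUB_union_of_inf_eq_zero (hs A) (hs B) (Set.mem_insert _ _) (Set.mem_insert _ _) ?_
    rintro _ (rfl | ⟨m, hm, rfl⟩) _ (rfl | ⟨n, hn, rfl⟩)
    · exact inf_idem 0
    · exact inf_of_le_left (hy n)
    · exact inf_of_le_right (hy m)
    · rw [← abs_of_nonneg (hy m), ← abs_of_nonneg (hy n)]
      exact hd m n (hAB.ne_of_mem hm hn)

end LatticeGroup

section Sequences

theorem exists_pairwise_disjoint_infinite_subsets {α : Type*} {N : Set α} (hN : N.Infinite) :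
    ∃ M : ℕ → Set α, (∀ i, M i ⊆ N) ∧ (∀ i, (M i).Infinite) ∧
      Pairwise fun i j => Disjoint (M i) (M j) := by
  let e : ℕ → ℕ → α := fun i k => hN.natEmbedding N (Nat.pair i k)
  have he : ∀ {i j k l}, e i k = e j l → i = j ∧ k = l := fun h =>
    Nat.pair_eq_pair.1 ((hN.natEmbedding N).injective (Subtype.ext h))
  refine ⟨fun i => Set.range (e i), ?_, fun i => ?_, fun i j hij => ?_⟩
  · rintro i _ ⟨k, rfl⟩
    exact Subtype.coe_prop _
  · exact Set.infinite_range_of_injective fun k l h => (he h).2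
  · refine Set.disjoint_left.2 ?_
    rintro _ ⟨k, rfl⟩ ⟨l, h⟩
    exact hij (he h).1.symm

/-- A form of Rosenthal's lemma. If it fails on each of infinitely many disjoint infinite `M i ⊆ N`,
at `n i` say, then the bound on the set of all `n i` improves by `δ`, whence induction on `j`. -/
theorem exists_infinite_subset_sdiff_singleton_le {α : Type*} {ν : α → Set α → ℝ} {δ : ℝ}
    (hδ : 0 ≤ δ) (hν : ∀ n A, 0 ≤ ν n A)
    (hadd : ∀ n A B, Disjoint A B → ν n A + ν n B ≤ ν n (A ∪ B)) (j : ℕ) {N : Set α}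
    (hN : N.Infinite) (hj : ∀ n ∈ N, ν n N ≤ j * δ) :
    ∃ M ⊆ N, M.Infinite ∧ ∀ n ∈ M, ν n (M \ {n}) ≤ δ := by
  have hmono : ∀ n, Monotone (ν n) := fun n A B hAB => by
    have h := hadd n A (B \ A) Set.disjoint_sdiff_right
    rw [Set.union_sdiff_cancel hAB] at h
    linarith [hν n (B \ A)]
  induction j generalizing N with
  | zero =>
    refine ⟨N, subset_rfl, hN, fun n hn => (hmono n Set.sdiff_subset).trans ?_⟩
    simpa using (hj n hn).trans (by simpa using hδ)
  | succ j ih =>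
    obtain ⟨M, hMN, hM, hdisj⟩ := exists_pairwise_disjoint_infinite_subsets hN
    by_contra! hbig
    choose n hnM hn using fun i => hbig (M i) (hMN i) (hM i)
    have hn_inj : Function.Injective n := fun i i' h => by
      by_contra hii'
      exact (hdisj hii').ne_of_mem (hnM i) (hnM i') h
    have hn_sub : Set.range n ⊆ N := Set.range_subset_iff.2 fun i => hMN i (hnM i)
    have hn_disj : ∀ i, Disjoint (Set.range n) (M i \ {n i}) := fun i => by
      rw [Set.disjoint_left]
      rintro _ ⟨i', rfl⟩ ⟨hi', hne⟩
      exact (hdisj fun h => hne (congrArg n h)).ne_of_mem (hnM i') hi' rfl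
    obtain ⟨M', hM'n, hM', hM'δ⟩ := ih (Set.infinite_range_of_injective hn_inj) <| by
      rintro _ ⟨i, rfl⟩
      have hunion := hmono (n i) (Set.union_subset hn_sub
        ((Set.sdiff_subset (t := {n i})).trans (hMN i)))
      have htotal := hj (n i) (hMN i (hnM i))
      push_cast at htotal
      linarith [hn i, hadd (n i) _ _ (hn_disj i)]
    obtain ⟨m, hm, hlt⟩ := hbig M' (hM'n.trans hn_sub) hM'
    exact (hM'δ m hm).not_gt hlt

theorem exists_strictMono_of_frequently_of_eventually {P : ℕ → Prop} {r : ℕ → ℕ → Prop}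
    (hP : ∃ᶠ n in atTop, P n) (hr : ∀ m, ∀ᶠ n in atTop, r m n) :
    ∃ θ : ℕ → ℕ, StrictMono θ ∧ (∀ n, P (θ n)) ∧ ∀ m n, m < n → r (θ m) (θ n) := by
  obtain ⟨θ, hPθ, hθ⟩ := exists_seq_of_forall_finset_exists P (fun m n => m < n ∧ r m n)
    fun s _ => (hP.and_eventually ((Finset.eventually_all s).2 fun m _ =>
      (eventually_gt_atTop m).and (hr m))).exists
  exact ⟨θ, fun m n h => (hθ m n h).1, hPθ, fun m n h => (hθ m n h).2⟩

theorem exists_injective_of_not_tendstoUniformlyOn {α : Type*} {F : ℕ → α → ℝ} {A : Set α}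
    (hF : ∀ a ∈ A, Tendsto (fun n => F n a) atTop (𝓝 0))
    (h : ¬ TendstoUniformlyOn F (fun _ => 0) atTop A) :
    ∃ ε > 0, ∃ θ : ℕ → ℕ, StrictMono θ ∧ ∃ z : ℕ → α, Function.Injective z ∧
      ∀ n, z n ∈ A ∧ ε ≤ |F (θ n) (z n)| := by
  simp only [Metric.tendstoUniformlyOn_iff, dist_zero_left, Real.norm_eq_abs, not_forall,
    not_eventually, not_lt] at h
  obtain ⟨ε, hε, hfreq⟩ := h
  obtain ⟨g, hg, hlt⟩ := exists_seq_of_forall_finset_exists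
    (fun q : ℕ × α => q.2 ∈ A ∧ ε ≤ |F q.1 q.2|) (fun q q' => q.1 < q'.1 ∧ q.2 ≠ q'.2)
    fun s hs => by
      have hsmall : ∀ q ∈ s, ∀ᶠ n in atTop, q.1 < n ∧ |F n q.2| < ε := fun q hq =>
        (eventually_gt_atTop q.1).and
          ((hF q.2 (hs q hq).1).abs.eventually_lt_const (by simpa using hε))
      obtain ⟨n, ⟨a, haA, ha⟩, hn⟩ :=
        (hfreq.and_eventually ((Finset.eventually_all s).2 hsmall)).exists
      refine ⟨(n, a), ⟨haA, ha⟩, fun q hq => ⟨(hn q hq).1, ?_⟩⟩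
      rintro rfl
      exact (hn q hq).2.not_ge ha
  exact ⟨ε, hε, fun n => (g n).1, fun m n h => (hlt m n h).1, fun n => (g n).2,
    Function.Injective.of_lt_imp_ne fun m n h => (hlt m n h).2, hg⟩

theorem two_mul_abs_rpow_le {p : ℝ} (hp : 1 ≤ p) (a b : ℝ) :
    2 * |a| ^ p ≤ |a + b| ^ p + |a - b| ^ p := by
  have hconv := (convexOn_rpow hp).2 (abs_nonneg (a + b)) (abs_nonneg (a - b))
    (by positivity : (0 : ℝ) ≤ 1 / 2) (by positivity : (0 : ℝ) ≤ 1 / 2) (by norm_num)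
  have hmid : |a| ≤ 1 / 2 * |a + b| + 1 / 2 * |a - b| := by
    have h := abs_add_le (a + b) (a - b)
    rw [add_add_sub_cancel, ← two_mul, abs_mul, abs_two] at h
    linarith
  have hpow := Real.rpow_le_rpow (abs_nonneg a) hmid (zero_le_one.trans hp)
  simp only [smul_eq_mul] at hconv
  linarith

/-- The row sums of a square matrix average, over all choices of signs of the columns, to at least
the diagonal; the signs are chosen one at a time. -/
theorem exists_signs_sum_diagonal_le {p : ℝ} (hp : 1 ≤ p) {ι : Type*} (a : ι → ι → ℝ)
    (s : Finset ι) :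
    ∃ ε : ι → ℝ, (∀ n, |ε n| = 1) ∧
      ∑ m ∈ s, |a m m| ^ p ≤ ∑ m ∈ s, |∑ n ∈ s, ε n * a m n| ^ p := by
  classical
  induction s using Finset.induction_on with
  | empty => exact ⟨1, by simp, by simp⟩
  | insert i s hi ih =>
    obtain ⟨ε, hε, hs⟩ := ih
    let b : ι → ℝ := fun m => ∑ n ∈ s, ε n * a m n
    have hrow : 2 * |a i i| ^ p ≤ |b i + a i i| ^ p + |b i - a i i| ^ p := by
      simpa only [add_comm (a i i), abs_sub_comm (a i i)] using two_mul_abs_rpow_le hp (a i i) (b i)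
    have hrows : 2 * ∑ m ∈ s, |b m| ^ p ≤
        ∑ m ∈ s, |b m + a m i| ^ p + ∑ m ∈ s, |b m - a m i| ^ p := by
      rw [Finset.mul_sum, ← Finset.sum_add_distrib]
      exact Finset.sum_le_sum fun m _ => two_mul_abs_rpow_le hp (b m) (a m i)
    have hsign : ∃ t : ℝ, |t| = 1 ∧
        ∑ m ∈ insert i s, |a m m| ^ p ≤ ∑ m ∈ insert i s, |b m + t * a m i| ^ p := by
      by_contra! hlt
      have hplus := hlt 1 (by simp)
      have hminus := hlt (-1) (by simp)
      simp only [Finset.sum_insert hi, one_mul, neg_one_mul, ← sub_eq_add_neg] at hplus hminus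
      linarith
    obtain ⟨t, ht, hle⟩ := hsign
    refine ⟨Function.update ε i t, fun n => ?_, hle.trans_eq (Finset.sum_congr rfl fun m _ => ?_)⟩
    · rcases eq_or_ne n i with rfl | hn
      · simpa using ht
      · simpa [hn] using hε n
    · rw [Finset.sum_insert hi, Function.update_self, add_comm]
      congr 3
      refine Finset.sum_congr rfl fun n hn => ?_
      rw [Function.update_of_ne (ne_of_mem_of_not_mem hn hi)]

end Sequences

section Dual

variable {X : Type*} [NormedAddCommGroup X] [NormedSpace ℝ X] {p : ℝ}

theorem isWeakStarNull_iff {f : ℕ → StrongDual ℝ X} :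
    IsWeakStarNull f ↔ ∀ x, Tendsto (fun n => f n x) atTop (𝓝 0) :=
  tendsto_iff_forall_eval_tendsto_topDualPairing

theorem IsWeakStarNull.comp_strictMono {f : ℕ → StrongDual ℝ X} (hf : IsWeakStarNull f)
    {θ : ℕ → ℕ} (hθ : StrictMono θ) : IsWeakStarNull (f ∘ θ) :=
  isWeakStarNull_iff.2 fun x => (isWeakStarNull_iff.1 hf x).comp hθ.tendsto_atTop

theorem IsWeakStarNull.exists_strictMono_apply_nsmul_sum_lt [PartialOrder X]
    [IsOrderedAddMonoid X] {f : ℕ → StrongDual ℝ X} (hf : IsWeakStarNull f)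
    (hmono : ∀ n, Monotone (f n)) {x : ℕ → X} (hx : ∀ n, 0 ≤ x n) {P : ℕ → Prop}
    (hP : ∃ᶠ n in atTop, P n) {δ : ℝ} (hδ : 0 < δ) :
    ∃ θ : ℕ → ℕ, StrictMono θ ∧ (∀ n, P (θ n)) ∧
      ∀ n, f (θ n) (2 ^ n • ∑ i ∈ Finset.range n, x (θ i)) < δ := by
  obtain ⟨θ, hθ, hPθ, hsmall⟩ := exists_strictMono_of_frequently_of_eventually hP fun m =>
    (isWeakStarNull_iff.1 hf
      (2 ^ (m + 1) • ∑ i ∈ Finset.range (m + 1), x i)).eventually_lt_const hδ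
  refine ⟨θ, hθ, hPθ, fun n => ?_⟩
  cases n with
  | zero => simpa using hδ
  | succ n =>
    refine (hmono _ ?_).trans_lt (hsmall n (n + 1) n.lt_succ_self)
    have hsub : (Finset.range (n + 1)).image θ ⊆ Finset.range (θ n + 1) := by
      refine Finset.image_subset_iff.2 fun i hi => Finset.mem_range_succ_iff.2 ?_
      exact hθ.monotone (Finset.mem_range_succ_iff.1 hi)
    calc 2 ^ (n + 1) • ∑ i ∈ Finset.range (n + 1), x (θ i)
        = 2 ^ (n + 1) • ∑ i ∈ (Finset.range (n + 1)).image θ, x i := by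
          rw [Finset.sum_image hθ.injective.injOn]
      _ ≤ 2 ^ (n + 1) • ∑ i ∈ Finset.range (θ n + 1), x i :=
          nsmul_le_nsmul_right (Finset.sum_le_sum_of_subset_of_nonneg hsub fun i _ _ => hx i) _
      _ ≤ 2 ^ (θ n + 1) • ∑ i ∈ Finset.range (θ n + 1), x i :=
          nsmul_le_nsmul_left (Finset.sum_nonneg fun i _ => hx i)
            (Nat.pow_le_pow_right two_pos (Nat.succ_le_succ hθ.le_apply))

theorem IsWeakStarNull.exists_norm_le [CompleteSpace X] {f : ℕ → StrongDual ℝ X}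
    (hf : IsWeakStarNull f) : ∃ C, ∀ n, ‖f n‖ ≤ C :=
  banach_steinhaus fun x => by
    obtain ⟨C, hC⟩ := (isWeakStarNull_iff.1 hf x).norm.bddAbove_range
    exact ⟨C, fun n => hC ⟨n, rfl⟩⟩

theorem tendsto_apply_of_tendstoUniformlyOn {α : Type*} {F : ℕ → α → ℝ} {A : Set α}
    (h : TendstoUniformlyOn F (fun _ => 0) atTop A) {z : ℕ → α} (hz : ∀ n, z n ∈ A) :
    Tendsto (fun n => F n (z n)) atTop (𝓝 0) :=
  Metric.tendsto_nhds.2 fun ε hε => (Metric.tendstoUniformlyOn_iff.1 h ε hε).mono fun n hn => by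
    simpa only [dist_comm] using hn (z n) (hz n)

theorem IsWeaklyPSummable.comp_injective {x : ℕ → X} (hx : IsWeaklyPSummable p x) {θ : ℕ → ℕ}
    (hθ : Function.Injective θ) : IsWeaklyPSummable p (x ∘ θ) :=
  fun φ => (hx φ).comp_injective hθ

theorem IsWeaklyPSummable.exists_sum_rpow_le (hp : 1 ≤ p) {x : ℕ → X}
    (hx : IsWeaklyPSummable p x) :
    ∃ C, 0 ≤ C ∧ ∀ (φ : StrongDual ℝ X) (s : Finset ℕ),
      ∑ n ∈ s, |φ (x n)| ^ p ≤ (C * ‖φ‖) ^ p := by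
  have hp0 : 0 < p := one_pos.trans_le hp
  have htoReal : (ENNReal.ofReal p).toReal = p := ENNReal.toReal_ofReal hp0.le
  have : Fact (1 ≤ ENNReal.ofReal p) := ⟨by simpa using hp⟩
  let T : Finset ℕ → StrongDual ℝ X →L[ℝ] lp (fun _ : ℕ => ℝ) (ENNReal.ofReal p) := fun s =>
    ∑ n ∈ s, (lp.singleContinuousLinearMap ℝ (fun _ : ℕ => ℝ) (ENNReal.ofReal p) n).comp
      (NormedSpace.inclusionInDoubleDual ℝ X (x n))
  have hT : ∀ s φ, ‖T s φ‖ ^ p = ∑ n ∈ s, |φ (x n)| ^ p := fun s φ => by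
    have h := lp.norm_sum_single (E := fun _ : ℕ => ℝ) (p := ENNReal.ofReal p)
      (by rwa [htoReal]) (fun n => φ (x n)) s
    rw [htoReal] at h
    simpa [T] using h
  obtain ⟨C, hC⟩ := banach_steinhaus (g := T) fun φ => by
    refine ⟨(∑' n, |φ (x n)| ^ p) ^ p⁻¹, fun s => ?_⟩
    rw [← Real.rpow_rpow_inv (norm_nonneg (T s φ)) hp0.ne', hT]
    exact Real.rpow_le_rpow (Finset.sum_nonneg fun n _ => by positivity)
      ((hx φ).sum_le_tsum s fun n _ => by positivity) (by positivity)
  refine ⟨C, (norm_nonneg _).trans (hC ∅), fun φ s => ?_⟩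
  rw [← hT]
  exact Real.rpow_le_rpow (norm_nonneg _) ((T s).le_of_opNorm_le (hC s) φ) hp0.le

theorem IsWeaklyPSummable.exists_norm_le (hp : 1 ≤ p) {x : ℕ → X} (hx : IsWeaklyPSummable p x) :
    ∃ C, ∀ n, ‖x n‖ ≤ C := by
  obtain ⟨C, hC0, hC⟩ := hx.exists_sum_rpow_le hp
  refine ⟨C, fun n => NormedSpace.norm_le_dual_bound ℝ _ hC0 fun φ => ?_⟩
  have h := hC φ {n}
  rw [Finset.sum_singleton] at h
  exact (Real.rpow_le_rpow_iff (abs_nonneg _) (by positivity) (by linarith)).1 h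

theorem IsWeaklyPSummable.isWeaklyPCompact_insert_zero_range (hp : p ≠ 0) {x : ℕ → X}
    (hx : IsWeaklyPSummable p x) : IsWeaklyPCompact p (insert 0 (Set.range x)) := by
  intro z hz
  by_cases hconst : ∃ a, ∃ᶠ n in atTop, z n = a
  · obtain ⟨a, ha⟩ := hconst
    obtain ⟨θ, hθ, hzθ⟩ := extraction_of_frequently_atTop ha
    refine ⟨a, hzθ 0 ▸ hz (θ 0), θ, hθ, fun φ => ?_⟩
    simp only [hzθ, sub_self, map_zero, abs_zero, Real.zero_rpow hp, summable_zero]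
  · simp only [not_exists, not_frequently] at hconst
    obtain ⟨θ, hθ, hne, hinj⟩ := exists_strictMono_of_frequently_of_eventually
      (hconst 0).frequently fun m => (hconst (z m)).mono fun n => Ne.symm
    choose k hk using fun n => (hz (θ n)).resolve_left (hne n)
    have hk_inj : Function.Injective k := Function.Injective.of_lt_imp_ne fun m n h hkmn =>
      hinj m n h (by rw [← hk m, ← hk n, hkmn])
    refine ⟨0, Set.mem_insert _ _, θ, hθ, ?_⟩
    simpa only [sub_zero, ← hk, Function.comp_def] using hx.comp_injective hk_inj

theorem IsWeaklyPCompact.isBounded (hp : 1 ≤ p) {K : Set X} (hK : IsWeaklyPCompact p K) :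
    Bornology.IsBounded K := by
  by_contra hunbdd
  simp only [isBounded_iff_forall_norm_le, not_exists, not_forall, not_le] at hunbdd
  choose x hxK hx using fun n : ℕ => hunbdd n
  obtain ⟨a, -, θ, hθ, hs⟩ := hK x hxK
  obtain ⟨C, hC⟩ := hs.exists_norm_le hp
  obtain ⟨n, hn⟩ := exists_nat_gt (C + ‖a‖)
  have hθn : (n : ℝ) ≤ θ n := by exact_mod_cast hθ.le_apply
  linarith [hC n, hx (θ n), norm_le_norm_add_norm_sub' (x (θ n)) a]

end Dual

section Modulus

variable {E : Type*} [NormedAddCommGroup E] [Lattice E] [HasSolidNorm E]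

theorem apply_le_norm_mul_norm_of_abs_le [NormedSpace ℝ E] (f : StrongDual ℝ E) {w z : E}
    (h : |w| ≤ z) : f w ≤ ‖f‖ * ‖z‖ :=
  (le_abs_self _).trans <| f.le_opNorm_of_le <|
    norm_le_norm_of_abs_le_abs (h.trans (le_abs_self z))

variable [IsOrderedAddMonoid E]

theorem norm_posPart_le (z : E) : ‖z⁺‖ ≤ ‖z‖ :=
  norm_le_norm_of_abs_le_abs <| by
    rw [abs_of_nonneg (posPart_nonneg z)]
    exact sup_le (le_abs_self z) (abs_nonneg z)

theorem norm_negPart_le (z : E) : ‖z⁻‖ ≤ ‖z‖ := by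
  simpa only [posPart_neg, norm_neg] using norm_posPart_le (-z)

variable [NormedSpace ℝ E]

theorem exists_continuousLinearMap_of_add_of_nonneg {F : Type*} [NormedAddCommGroup F]
    [NormedSpace ℝ F] {m : E → F} (hadd : ∀ y z, 0 ≤ y → 0 ≤ z → m (y + z) = m y + m z) {C : ℝ}
    (hC : ∀ z, 0 ≤ z → ‖m z‖ ≤ C * ‖z‖) : ∃ g : E →L[ℝ] F, ∀ z, 0 ≤ z → g z = m z := by
  have hm0 : m 0 = 0 := by simpa using hadd 0 0 le_rfl le_rfl
  have hdiff : ∀ y z, m (y + z)⁺ - m (y + z)⁻ = m y⁺ - m y⁻ + (m z⁺ - m z⁻) := fun y z => by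
    have hparts : (y + z)⁺ + (y⁻ + z⁻) = y⁺ + z⁺ + (y + z)⁻ := by
      rw [← sub_eq_sub_iff_add_eq_add, posPart_sub_negPart, add_sub_add_comm,
        posPart_sub_negPart, posPart_sub_negPart]
    have hm := congrArg m hparts
    have hpos := add_nonneg (posPart_nonneg y) (posPart_nonneg z)
    have hneg := add_nonneg (negPart_nonneg y) (negPart_nonneg z)
    rw [hadd _ _ (posPart_nonneg _) hneg, hadd _ _ hpos (negPart_nonneg _),
      hadd _ _ (posPart_nonneg y) (posPart_nonneg z),
      hadd _ _ (negPart_nonneg y) (negPart_nonneg z)] at hm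
    rw [sub_add_sub_comm, sub_eq_sub_iff_add_eq_add, hm]
  let T : E →+ F := AddMonoidHom.mk' (fun z => m z⁺ - m z⁻) hdiff
  have hT : ∀ z, ‖T z‖ ≤ 2 * |C| * ‖z‖ := fun z =>
    calc ‖m z⁺ - m z⁻‖ ≤ C * ‖z⁺‖ + C * ‖z⁻‖ :=
          (norm_sub_le _ _).trans (add_le_add (hC _ (posPart_nonneg z)) (hC _ (negPart_nonneg z)))
      _ ≤ |C| * ‖z‖ + |C| * ‖z‖ := add_le_add
          (mul_le_mul (le_abs_self C) (norm_posPart_le z) (norm_nonneg _) (abs_nonneg C))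
          (mul_le_mul (le_abs_self C) (norm_negPart_le z) (norm_nonneg _) (abs_nonneg C))
      _ = 2 * |C| * ‖z‖ := by ring
  refine ⟨T.toRealLinearMap (AddMonoidHomClass.continuous_of_bound T _ hT), fun z hz => ?_⟩
  change m z⁺ - m z⁻ = m z
  rw [posPart_of_nonneg hz, negPart_of_nonneg hz, hm0, sub_zero]

theorem exists_isLUB_image_principalIdeal (f : StrongDual ℝ E) (u : E) :
    ∃ g : StrongDual ℝ E, ∀ z, 0 ≤ z →
      IsLUB (f '' {w ∈ (principalIdeal u : Set E) | |w| ≤ z}) (g z) := by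
  have hbound : ∀ z, ‖f‖ * ‖z‖ ∈ upperBounds (f '' {w ∈ (principalIdeal u : Set E) | |w| ≤ z}) := by
    rintro z _ ⟨w, hw, rfl⟩
    exact apply_le_norm_mul_norm_of_abs_le f hw.2
  have hzero : ∀ {z : E}, 0 ≤ z → 0 ∈ f '' {w ∈ (principalIdeal u : Set E) | |w| ≤ z} := fun hz =>
    ⟨0, ⟨zero_mem _, by simpa using hz⟩, map_zero f⟩
  let m : E → ℝ := fun z => sSup (f '' {w ∈ (principalIdeal u : Set E) | |w| ≤ z})
  have hm : ∀ z, 0 ≤ z → IsLUB (f '' {w ∈ (principalIdeal u : Set E) | |w| ≤ z}) (m z) :=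
    fun z hz => isLUB_csSup ⟨0, hzero hz⟩ ⟨_, hbound z⟩
  have hadd : ∀ y z, 0 ≤ y → 0 ≤ z → m (y + z) = m y + m z := fun y z hy hz => by
    refine (hm _ (add_nonneg hy hz)).unique ?_
    rw [principalIdeal_abs_le_add u hy hz, Set.image_add]
    exact (hm y hy).add (hm z hz)
  obtain ⟨g, hg⟩ := exists_continuousLinearMap_of_add_of_nonneg hadd (C := ‖f‖) fun z hz => by
    rw [Real.norm_of_nonneg ((hm z hz).1 (hzero hz))]
    exact (hm z hz).2 (hbound z)
  exact ⟨g, fun z hz => by rw [hg z hz]; exact hm z hz⟩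

/-- The component of `|f|` carried by the ideal generated by `u`: at `z ≥ 0` it is the supremum of
`f` over the `w` in that ideal with `|w| ≤ z`. Restricting `w` to the ideal replaces the band
projection onto `u`, which need not exist. -/
noncomputable def modulusOn (f : StrongDual ℝ E) (u : E) : StrongDual ℝ E :=
  (exists_isLUB_image_principalIdeal f u).choose

variable {f : StrongDual ℝ E} {u : E}

theorem isLUB_modulusOn (f : StrongDual ℝ E) (u : E) {z : E} (hz : 0 ≤ z) :
    IsLUB (f '' {w ∈ (principalIdeal u : Set E) | |w| ≤ z}) (modulusOn f u z) :=
  (exists_isLUB_image_principalIdeal f u).choose_spec z hz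

theorem apply_le_modulusOn {w z : E} (hw : w ∈ principalIdeal u) (h : |w| ≤ z) :
    f w ≤ modulusOn f u z :=
  (isLUB_modulusOn f u ((abs_nonneg w).trans h)).1 ⟨w, ⟨hw, h⟩, rfl⟩

theorem abs_apply_le_modulusOn {w z : E} (hw : w ∈ principalIdeal u) (h : |w| ≤ z) :
    |f w| ≤ modulusOn f u z :=
  abs_le'.2 ⟨apply_le_modulusOn hw h, by
    rw [← map_neg]
    exact apply_le_modulusOn (neg_mem hw) (by rwa [abs_neg])⟩

theorem modulusOn_le {z : E} (hz : 0 ≤ z) {b : ℝ} (h : ∀ w ∈ principalIdeal u, |w| ≤ z → f w ≤ b) :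
    modulusOn f u z ≤ b :=
  (isLUB_modulusOn f u hz).2 <| by
    rintro _ ⟨w, hw, rfl⟩
    exact h w hw.1 hw.2

theorem modulusOn_le_norm_mul_norm {z : E} (hz : 0 ≤ z) : modulusOn f u z ≤ ‖f‖ * ‖z‖ :=
  modulusOn_le hz fun _ _ => apply_le_norm_mul_norm_of_abs_le f

theorem exists_lt_apply_of_lt_modulusOn {z : E} (hz : 0 ≤ z) {b : ℝ} (h : b < modulusOn f u z) :
    ∃ w ∈ principalIdeal u, |w| ≤ z ∧ b < f w := by
  obtain ⟨_, ⟨w, hw, rfl⟩, hb⟩ := (lt_isLUB_iff (isLUB_modulusOn f u hz)).1 h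
  exact ⟨w, hw.1, hw.2, hb⟩

theorem modulusOn_nonneg {z : E} (hz : 0 ≤ z) : 0 ≤ modulusOn f u z := by
  simpa using apply_le_modulusOn (f := f) (zero_mem (principalIdeal u)) (abs_zero.trans_le hz)

theorem monotone_modulusOn (f : StrongDual ℝ E) (u : E) : Monotone (modulusOn f u) :=
  (monotone_iff_map_nonneg _).2 fun _ => modulusOn_nonneg

theorem sum_modulusOn_le {ι : Type*} {s : Finset ι} {u : ι → E}
    (hd : (s : Set ι).Pairwise fun i j => |u i| ⊓ |u j| = 0) {z : E} (hz : 0 ≤ z) :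
    ∑ i ∈ s, modulusOn f (u i) z ≤ ‖f‖ * ‖z‖ := by
  refine (isLUB_finset_sum fun i _ => isLUB_modulusOn f (u i) hz).2 ?_
  rintro _ hsum
  obtain ⟨b, hb, rfl⟩ := (Set.mem_finsetSum _ _ _).1 hsum
  choose! w hw hfw using fun i => @hb i
  rw [Finset.sum_congr rfl fun i hi => (hfw i hi).symm, ← map_sum]
  refine apply_le_norm_mul_norm_of_abs_le f ((abs_finset_sum_le s w).trans ?_)
  exact sum_le_of_pairwise_inf_eq_zero hz (fun i _ => abs_nonneg (w i)) (fun i hi => (hw i hi).2)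
    fun i hi j hj hij =>
      abs_inf_abs_eq_zero_of_mem_principalIdeal (hd hi hj hij) (hw i hi).1 (hw j hj).1

theorem modulusOn_apply_eq_zero {v : E} (hv : 0 ≤ v) (h : |u| ⊓ |v| = 0) : modulusOn f u v = 0 := by
  refine (modulusOn_le hv fun w hw hwv => ?_).antisymm (modulusOn_nonneg hv)
  have hw0 := abs_inf_abs_eq_zero_of_mem_principalIdeal h hw
    (mem_principalIdeal_of_abs_le (hwv.trans (le_abs_self v)))
  rw [inf_idem] at hw0
  rw [norm_eq_zero.1 ((norm_abs_eq_norm w).symm.trans (by rw [hw0, norm_zero])), map_zero]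

/-- The functional `h` is `μ` on the ideal of `x⁺` and `-μ` on the complementary part. -/
theorem exists_apply_eq_apply_abs {μ : StrongDual ℝ E} (hμ : Monotone μ) (x : E) :
    ∃ h : StrongDual ℝ E, h x = μ |x| ∧ ∀ z, |h z| ≤ μ |z| := by
  let ν := modulusOn μ x⁺
  have hνμ : ∀ {z : E}, 0 ≤ z → ν z ≤ μ z := fun hz =>
    modulusOn_le hz fun w _ hw => hμ ((le_abs_self w).trans hw)
  have hpos : ν x⁺ = μ x⁺ :=
    (hνμ (posPart_nonneg x)).antisymm (apply_le_modulusOn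
      (mem_principalIdeal_of_abs_le le_rfl) (abs_of_nonneg (posPart_nonneg x)).le)
  have hneg : ν x⁻ = 0 := by
    refine modulusOn_apply_eq_zero (negPart_nonneg x) ?_
    rw [abs_of_nonneg (posPart_nonneg x), abs_of_nonneg (negPart_nonneg x),
      posPart_inf_negPart_eq_zero]
  refine ⟨ν - (μ - ν), ?_, fun z => ?_⟩
  · rw [← posPart_add_negPart x]
    nth_rw 1 [← posPart_sub_negPart x]
    simp only [_root_.sub_apply, map_sub, map_add, hpos, hneg]
    ring
  · have hcompl : Monotone (μ - ν) := (monotone_iff_map_nonneg _).2 fun w hw =>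
      sub_nonneg.2 (hνμ hw)
    have hν := abs_map_le_map_abs (monotone_modulusOn μ x⁺) z
    have hμν := abs_map_le_map_abs hcompl z
    calc |ν z - (μ - ν) z| ≤ |ν z| + |(μ - ν) z| := abs_sub _ _
      _ ≤ ν |z| + (μ - ν) |z| := add_le_add hν hμν
      _ = μ |z| := by rw [_root_.sub_apply, add_sub_cancel]

end Modulus

section DunfordPettis

variable {E : Type*} [NormedAddCommGroup E] [NormedSpace ℝ E] [Lattice E] [IsOrderedAddMonoid E]
  [HasSolidNorm E] {p : ℝ}

theorem IsWeaklyPSummable.of_disjoint_of_abs_le (hp : 1 ≤ p) {x y : ℕ → E}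
    (hx : IsWeaklyPSummable p x) (hd : IsDisjointSeq y) (hyx : ∀ n, |y n| ≤ |x n|) :
    IsWeaklyPSummable p y := by
  intro φ
  have hp0 : 0 ≤ p := zero_le_one.trans hp
  obtain ⟨C, hC0, hC⟩ := hx.exists_sum_rpow_le hp
  choose h hhx hh using fun n => exists_apply_eq_apply_abs (monotone_modulusOn φ (y n)) (x n)
  have hφh : ∀ n, |φ (y n)| ≤ |h n (x n)| := fun n => by
    rw [hhx]
    exact (abs_apply_le_modulusOn (mem_principalIdeal_of_abs_le le_rfl) (hyx n)).trans
      (le_abs_self _)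
  refine summable_of_sum_le (c := (C * ‖φ‖) ^ p) (fun n => by positivity) fun s => ?_
  obtain ⟨ε, hε, hdiag⟩ := exists_signs_sum_diagonal_le hp (fun m n => h n (x m)) s
  let ψ : StrongDual ℝ E := ∑ n ∈ s, ε n • h n
  have hψ : ∀ z, ψ z = ∑ n ∈ s, ε n * h n z := fun z => by simp [ψ]
  have hψφ : ‖ψ‖ ≤ ‖φ‖ := by
    refine ψ.opNorm_le_bound (norm_nonneg φ) fun z => ?_
    calc |ψ z| ≤ ∑ n ∈ s, |ε n * h n z| := by
          rw [hψ]
          exact Finset.abs_sum_le_sum_abs _ _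
      _ ≤ ∑ n ∈ s, modulusOn φ (y n) |z| := Finset.sum_le_sum fun n _ => by
          rw [abs_mul, hε, one_mul]
          exact hh n z
      _ ≤ ‖φ‖ * ‖z‖ := by
          rw [← norm_abs_eq_norm z]
          exact sum_modulusOn_le (fun i _ j _ hij => hd i j hij) (abs_nonneg z)
  calc ∑ n ∈ s, |φ (y n)| ^ p
      ≤ ∑ n ∈ s, |h n (x n)| ^ p :=
        Finset.sum_le_sum fun n _ => Real.rpow_le_rpow (abs_nonneg _) (hφh n) hp0
    _ ≤ ∑ m ∈ s, |ψ (x m)| ^ p := by simpa only [hψ] using hdiag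
    _ ≤ (C * ‖ψ‖) ^ p := hC ψ s
    _ ≤ (C * ‖φ‖) ^ p := by gcongr

theorem exists_infinite_subset_abs_apply_sdiff_singleton_le {f : ℕ → StrongDual ℝ E} {C : ℝ}
    (hf : ∀ n, ‖f n‖ ≤ C) {s : Set ℕ → E} {x : E} (hs : ∀ A, 0 ≤ s A ∧ s A ≤ x)
    (hadd : ∀ A B, Disjoint A B → s (A ∪ B) = s A + s B) {δ : ℝ} (hδ : 0 < δ) {N : Set ℕ}
    (hN : N.Infinite) : ∃ M ⊆ N, M.Infinite ∧ ∀ n ∈ M, |f n (s (M \ {n}))| ≤ δ := by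
  have hx : 0 ≤ x := (hs ∅).1.trans (hs ∅).2
  obtain ⟨j, hj⟩ := exists_nat_gt (C * ‖x‖ / δ)
  rw [div_lt_iff₀ hδ] at hj
  obtain ⟨M, hMN, hM, hMs⟩ := exists_infinite_subset_sdiff_singleton_le
    (ν := fun n A => modulusOn (f n) x (s A)) hδ.le (fun n A => modulusOn_nonneg (hs A).1)
    (fun n A B hAB => by rw [hadd A B hAB, map_add]) j hN fun n _ =>
      calc modulusOn (f n) x (s N) ≤ modulusOn (f n) x x := monotone_modulusOn _ _ (hs N).2
        _ ≤ ‖f n‖ * ‖x‖ := modulusOn_le_norm_mul_norm hx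
        _ ≤ C * ‖x‖ := mul_le_mul_of_nonneg_right (hf n) (norm_nonneg x)
        _ ≤ j * δ := hj.le
  refine ⟨M, hMN, hM, fun n hn => (abs_apply_le_modulusOn ?_ ?_).trans (hMs n hn)⟩
  · refine mem_principalIdeal_of_abs_le ?_
    rw [abs_of_nonneg (hs _).1, abs_of_nonneg hx]
    exact (hs _).2
  · exact (abs_of_nonneg (hs _).1).le

theorem IsWeakStarNull.tendsto_apply_of_disjoint_of_nonneg [CompleteSpace E]
    (hE : IsSigmaDedekindComplete E) {f : ℕ → StrongDual ℝ E} (hf : IsWeakStarNull f) {y : ℕ → E}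
    {x : E} (hd : IsDisjointSeq y) (hy : ∀ n, 0 ≤ y n) (hyx : ∀ n, y n ≤ x) :
    Tendsto (fun n => f n (y n)) atTop (𝓝 0) := by
  obtain ⟨s, hs, hsy, hadd⟩ := hE.exists_additive_of_isDisjointSeq hd hy hyx
  obtain ⟨C, hC⟩ := hf.exists_norm_le
  by_contra hnot
  simp only [Metric.tendsto_nhds, dist_zero_right, Real.norm_eq_abs, not_forall, not_eventually,
    not_lt] at hnot
  obtain ⟨ε, hε, hfreq⟩ := hnot
  obtain ⟨M, hMε, hM, hMs⟩ := exists_infinite_subset_abs_apply_sdiff_singleton_le hC hs hadd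
    (half_pos hε) (Nat.frequently_atTop_iff_infinite.1 hfreq)
  have hlim : ∀ᶠ n in atTop, |f n (s M)| < ε / 2 :=
    (isWeakStarNull_iff.1 hf (s M)).abs.eventually_lt_const (by simpa using hε)
  obtain ⟨n, hnM, hn⟩ := ((Nat.frequently_atTop_iff_infinite.2 hM).and_eventually hlim).exists
  have hsM : s M = y n + s (M \ {n}) := by
    rw [← hsy, ← hadd _ _ Set.disjoint_sdiff_right,
      Set.union_sdiff_cancel (Set.singleton_subset_iff.2 hnM)]
  have htri := abs_sub (f n (s M)) (f n (s (M \ {n})))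
  rw [← map_sub, hsM, add_sub_cancel_right, ← hsM] at htri
  have hεn : ε ≤ |f n (y n)| := hMε hnM
  linarith [hMs n hnM]

theorem IsWeakStarNull.tendsto_apply_of_disjoint [CompleteSpace E]
    (hE : IsSigmaDedekindComplete E) {f : ℕ → StrongDual ℝ E} (hf : IsWeakStarNull f) {y : ℕ → E}
    {x : E} (hd : IsDisjointSeq y) (hyx : ∀ n, |y n| ≤ x) :
    Tendsto (fun n => f n (y n)) atTop (𝓝 0) := by
  have hlim : ∀ z : ℕ → E, (∀ n, 0 ≤ z n) → (∀ n, z n ≤ |y n|) →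
      Tendsto (fun n => f n (z n)) atTop (𝓝 0) := fun z hz hzy =>
    hf.tendsto_apply_of_disjoint_of_nonneg hE
      (hd.mono fun n => (abs_of_nonneg (hz n)).trans_le (hzy n)) hz
      fun n => (hzy n).trans (hyx n)
  have hpos := hlim (fun n => (y n)⁺) (fun n => posPart_nonneg _)
    fun n => sup_le (le_abs_self _) (abs_nonneg _)
  have hneg := hlim (fun n => (y n)⁻) (fun n => negPart_nonneg _)
    fun n => sup_le (neg_le_abs _) (abs_nonneg _)
  simpa only [← map_sub, posPart_sub_negPart, sub_zero] using hpos.sub hneg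

theorem IsWeakStarNull.modulusOn_of_disjoint [CompleteSpace E] (hE : IsSigmaDedekindComplete E)
    {f : ℕ → StrongDual ℝ E} (hf : IsWeakStarNull f) {x : ℕ → E} (hd : IsDisjointSeq x) :
    IsWeakStarNull fun n => modulusOn (f n) (x n) := by
  have hlim : ∀ z, 0 ≤ z → Tendsto (fun n => modulusOn (f n) (x n) z) atTop (𝓝 0) := fun z hz => by
    choose w hwx hwz hw using fun n : ℕ => exists_lt_apply_of_lt_modulusOn (f := f n) (u := x n) hz
      (sub_lt_self _ (Nat.one_div_pos_of_nat (α := ℝ) (n := n)))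
    have hfw := hf.tendsto_apply_of_disjoint hE (fun m n hmn =>
      abs_inf_abs_eq_zero_of_mem_principalIdeal (hd m n hmn) (hwx m) (hwx n)) hwz
    have hbound := hfw.add tendsto_one_div_add_atTop_nhds_zero_nat
    rw [add_zero] at hbound
    exact squeeze_zero (fun n => modulusOn_nonneg hz) (fun n => (sub_lt_iff_lt_add.1 (hw n)).le)
      hbound
  refine isWeakStarNull_iff.2 fun z => ?_
  simpa only [← map_sub, posPart_sub_negPart, sub_zero] using
    (hlim _ (posPart_nonneg z)).sub (hlim _ (negPart_nonneg z))

theorem HasPositiveDPStar.hasDisjointDPStar [CompleteSpace E] (hE : IsSigmaDedekindComplete E)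
    (hp : 1 ≤ p) (h : HasPositiveDPStar p E) : HasDisjointDPStar p E := by
  intro x hd hx f hf
  by_contra hnot
  obtain ⟨ε, hε, θ, hθ, z, hz, hzε⟩ := exists_injective_of_not_tendstoUniformlyOn
    (fun a _ => isWeakStarNull_iff.1 hf a) hnot
  choose k hk using fun n => (hzε n).1
  obtain rfl : x ∘ k = z := funext hk
  have hg : IsWeakStarNull fun n => modulusOn (f (θ n)) (x (k n)) :=
    (hf.comp_strictMono hθ).modulusOn_of_disjoint hE (hd.comp_injective hz.of_comp)
  have habs : IsWeaklyPSummable p fun n => |x n| :=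
    hx.of_disjoint_of_abs_le hp (hd.mono fun n => (abs_abs _).le) fun n => (abs_abs _).le
  have hlimited := (h _ (habs.isWeaklyPCompact_insert_zero_range (by linarith))).2 _
    (fun n _ => modulusOn_nonneg) hg
  have hlim := tendsto_apply_of_tendstoUniformlyOn hlimited (z := fun n => |x (k n)|)
    fun n => Set.mem_insert_of_mem _ ⟨k n, rfl⟩
  exact hε.not_ge (ge_of_tendsto' hlim fun n => (hzε n).2.trans
    (abs_apply_le_modulusOn (mem_principalIdeal_of_abs_le le_rfl) le_rfl))

theorem exists_forall_abs_le_two_pow_nsmul [CompleteSpace E] {x : ℕ → E} {C : ℝ}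
    (hx : ∀ n, ‖x n‖ ≤ C) : ∃ s, 0 ≤ s ∧ ∀ n, |x n| ≤ 2 ^ n • s := by
  have hsummable : Summable fun n => |(2⁻¹ : ℝ) ^ n • x n| := by
    refine Summable.of_norm_bounded (g := fun n => (2⁻¹ : ℝ) ^ n * C)
      ((summable_geometric_of_lt_one (by norm_num) (by norm_num)).mul_right C) fun n => ?_
    rw [norm_abs_eq_norm, norm_smul, Real.norm_of_nonneg (by positivity)]
    exact mul_le_mul_of_nonneg_left (hx n) (by positivity)
  refine ⟨∑' n, |(2⁻¹ : ℝ) ^ n • x n|, tsum_nonneg fun n => abs_nonneg _, fun n => ?_⟩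
  calc |x n| = |2 ^ n • (2⁻¹ : ℝ) ^ n • x n| := by
        rw [← Nat.cast_smul_eq_nsmul ℝ, smul_smul, Nat.cast_pow, Nat.cast_ofNat, ← mul_pow,
          mul_inv_cancel₀ two_ne_zero, one_pow, one_smul]
    _ ≤ 2 ^ n • |(2⁻¹ : ℝ) ^ n • x n| := abs_nsmul_le _ _
    _ ≤ 2 ^ n • ∑' n, |(2⁻¹ : ℝ) ^ n • x n| :=
        nsmul_le_nsmul_right (hsummable.le_tsum n fun i _ => abs_nonneg _) _

theorem HasDisjointDPStar.tendsto_apply_abs [CompleteSpace E] (hp : 1 ≤ p)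
    (h : HasDisjointDPStar p E) {f : ℕ → StrongDual ℝ E} (hf : IsWeakStarNull f)
    (hmono : ∀ n, Monotone (f n)) {x : ℕ → E} (hx : IsWeaklyPSummable p x) :
    Tendsto (fun n => f n |x n|) atTop (𝓝 0) := by
  refine tendsto_order.2 ⟨fun b hb => .of_forall fun n => hb.trans_le ?_, fun ε hε => ?_⟩
  · exact (abs_nonneg _).trans (abs_map_le_map_abs (hmono n) (x n))
  by_contra hfreq
  simp only [not_eventually, not_lt] at hfreq
  obtain ⟨θ, hθ, hxθ, hsmall⟩ := hf.exists_strictMono_apply_nsmul_sum_lt hmono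
    (fun n => abs_nonneg (x n)) hfreq (by positivity : 0 < ε / 3)
  obtain ⟨C, hC⟩ := hx.exists_norm_le hp
  obtain ⟨s, hs, hxs⟩ := exists_forall_abs_le_two_pow_nsmul fun n => hC (θ n)
  let t : ℕ → E := fun n => 2 ^ n • ∑ i ∈ Finset.range n, |x (θ i)|
  have ht : ∀ n, 0 ≤ t n := fun n => nsmul_nonneg (Finset.sum_nonneg fun i _ => abs_nonneg _) _
  have hd : IsDisjointSeq fun n => (|x (θ n)| - t n - s)⁺ :=
    isDisjointSeq_posPart_sub hs (fun n => abs_nonneg _) hxs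
  have hsummable : IsWeaklyPSummable p fun n => (|x (θ n)| - t n - s)⁺ :=
    (hx.comp_injective hθ.injective).of_disjoint_of_abs_le hp hd fun n => by
      rw [abs_of_nonneg (posPart_nonneg _)]
      exact sup_le ((sub_le_self _ hs).trans (sub_le_self _ (ht n))) (abs_nonneg _)
  have hfθ := hf.comp_strictMono hθ
  have hlim := tendsto_apply_of_tendstoUniformlyOn (h _ hd hsummable _ hfθ) Set.mem_range_self
  obtain ⟨n, hv, hfs⟩ := ((hlim.eventually_lt_const (by positivity : 0 < ε / 3)).and
    ((isWeakStarNull_iff.1 hfθ s).eventually_lt_const (by positivity : 0 < ε / 3))).exists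
  have hle := (hmono (θ n) (le_posPart (|x (θ n)| - t n - s))).trans_lt hv
  rw [map_sub, map_sub] at hle
  simp only [Function.comp_apply] at hfs
  linarith [hxθ n, hsmall n]

theorem HasDisjointDPStar.hasPositiveDPStar [CompleteSpace E] (hp : 1 ≤ p)
    (h : HasDisjointDPStar p E) : HasPositiveDPStar p E := by
  refine fun K hK => ⟨hK.isBounded hp, fun f hpos hf => ?_⟩
  by_contra hnot
  obtain ⟨ε, hε, θ, hθ, x, -, hx⟩ := exists_injective_of_not_tendstoUniformlyOn
    (fun a _ => isWeakStarNull_iff.1 hf a) hnot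
  obtain ⟨a, -, ψ, hψ, hs⟩ := hK x fun n => (hx n).1
  have hf' := hf.comp_strictMono (hθ.comp hψ)
  have hmono : ∀ n, Monotone (f n) := fun n => (monotone_iff_map_nonneg _).2 (hpos n)
  have hlim := (h.tendsto_apply_abs hp hf' (fun n => hmono _) hs).add
    (isWeakStarNull_iff.1 hf' a).abs
  rw [abs_zero, add_zero] at hlim
  refine hε.not_ge (ge_of_tendsto' hlim fun n => (hx (ψ n)).2.trans ?_)
  calc |f (θ (ψ n)) (x (ψ n))| ≤ |f (θ (ψ n)) (x (ψ n) - a)| + |f (θ (ψ n)) a| := by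
        rw [← sub_le_iff_le_add, map_sub]
        exact abs_sub_abs_le_abs_sub _ _
    _ ≤ f (θ (ψ n)) |x (ψ n) - a| + |f (θ (ψ n)) a| :=
        add_le_add_left (abs_map_le_map_abs (hmono _) _) _

end DunfordPettis

end BanachLattice

theorem corollary3p8_general {E : Type*} [NormedAddCommGroup E] [NormedSpace ℝ E] [CompleteSpace E]
    [Lattice E] [IsOrderedAddMonoid E] [HasSolidNorm E]
    (hE : BanachLattice.IsSigmaDedekindComplete E) {p : ℝ} (hp : 1 ≤ p) :
    BanachLattice.HasPositiveDPStar p E ↔ BanachLattice.HasDisjointDPStar p E :=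
  ⟨fun h => h.hasDisjointDPStar hE hp, fun h => h.hasPositiveDPStar hp⟩

theorem corollary3p8 {E : Type*} [NormedAddCommGroup E] [NormedSpace ℝ E] [CompleteSpace E]
    [Lattice E] [IsOrderedAddMonoid E] [IsOrderedModule ℝ E] [HasSolidNorm E]
    (hE : BanachLattice.IsSigmaDedekindComplete E) (p : ℝ) (hp : 2 ≤ p) :
    BanachLattice.HasPositiveDPStar p E ↔ BanachLattice.HasDisjointDPStar p E :=
  corollary3p8_general hE (one_le_two.trans hp)
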